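/- Let $K$ be an algebraically closed field, $\Lambda$ a finite-dimensional $K$-algebra, and $G$ a finite abelian group acting on $\Lambda$ by $K$-algebra automorphisms, whose order $|G|$ is invertible in $K$. Let $\Lambda G$ be the skew group algebra, that is, $\Lambda\otimes_K KG$ with multiplication $(\lambda\otimes g)(\mu\otimes h)=\lambda\, g(\mu)\otimes gh$. For an algebra $A$ let $\mathrm{mod}\,A$ be the category of finitely generated left $A$-modules, and let $F_\lambda:\mathrm{mod}\,\Lambda\to\mathrm{mod}\,\Lambda G$ be the push-down functor (the Galois semi-covering of module categories) $F_\lambda M=\Lambda G\otimes_\Lambda M$: explicitly, $F_\lambda M=\bigoplus_{k\in G}M$ with $\big((\lambda\otimes h)\varphi\big)_k=k^{-1}(\lambda)\,\varphi_{h^{-1}k}$, and $F_\lambda f$ is $f$ in every component. The radical $\mathrm{rad}_A$ of $\mathrm{mod}\,A$ is the two-sided ideal generated by the non-invertible morphisms between indecomposable objects. A product $IJ$ of two ideals consists of the finite sums of composites $g\circ f$ with $g\in I$ and $f\in J$. Put $\mathrm{rad}_A^0=$ the ideal of all morphisms, $\mathrm{rad}_A^{n}=\mathrm{rad}_A^{n-1}\,\mathrm{rad}_A$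 for $1\le n<\omega$, and, for a limit ordinal $\mu$, $\mathrm{rad}_A^\mu=\bigcap_{\beta<\mu}\mathrm{rad}_A^\beta$ and $\mathrm{rad}_A^{\mu+n}=(\mathrm{rad}_A^\mu)^{n+1}$ for $0\le n<\omega$. Then $F_\lambda$ preserves all powers of the radical. That is, for every ordinal $\alpha$, all $M,N\in\mathrm{mod}\,\Lambda$ and every morphism $f:M\to N$: if $f\in\mathrm{rad}_\Lambda^\alpha(M,N)$, then $F_\lambda(f)\in\mathrm{rad}_{\Lambda G}^\alpha(F_\lambda M,F_\lambda N)$; and if $f\in\mathrm{rad}_\Lambda^{\alpha}(M,N)\setminus\mathrm{rad}_\Lambda^{\alpha+1}(M,N)$, then $F_\lambda(f)\in\mathrm{rad}_{\Lambda G}^{\alpha}(F_\lambda M,F_\lambda N)\setminus\mathrm{rad}_{\Lambda G}^{\alpha+1}(F_\lambda M,F_\lambda N)$. -/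

import Mathlib

open CategoryTheory CategoryTheory.Limits

universe u v w

noncomputable section

/-! ### Two-sided ideals of a preadditive category -/

/-- A two-sided ideal of a preadditive category: a subgroup of every group of morphisms, stable
under composition with arbitrary morphisms on both sides. -/
@[ext]
structure CatIdeal (C : Type u) [Category.{v} C] [Preadditive C] where
  hom : ∀ X Y : C, AddSubgroup (X ⟶ Y)
  comp_mem : ∀ {W X Y : C} (a : W ⟶ X) {f : X ⟶ Y}, f ∈ hom X Y → a ≫ f ∈ hom W Y
  mem_comp : ∀ {X Y Z : C} {f : X ⟶ Y} (b : Y ⟶ Z), f ∈ hom X Y → f ≫ b ∈ hom X Z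

namespace CatIdeal

variable {C : Type u} [Category.{v} C] [Preadditive C]

/-- The ideal of all morphisms. -/
def all : CatIdeal C where
  hom _ _ := ⊤
  comp_mem _ _ _ := trivial
  mem_comp _ _ := trivial

/-- The intersection of a family of ideals. -/
def inter {ι : Sort*} (I : ι → CatIdeal C) : CatIdeal C where
  hom X Y := ⨅ i, (I i).hom X Y
  comp_mem a _ hf := by
    simp only [AddSubgroup.mem_iInf] at hf ⊢
    exact fun i => (I i).comp_mem a (hf i)
  mem_comp b hf := by
    simp only [AddSubgroup.mem_iInf] at hf ⊢
    exact fun i => (I i).mem_comp b (hf i)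

/-- The ideal generated by a class `S` of morphisms: finite sums of `± b ∘ s ∘ a`, `s` in `S`. -/
def generate (S : ∀ X Y : C, Set (X ⟶ Y)) : CatIdeal C where
  hom X Y := AddSubgroup.closure
    {h | ∃ (X' Y' : C) (a : X ⟶ X') (s : X' ⟶ Y') (b : Y' ⟶ Y), s ∈ S X' Y' ∧ h = a ≫ s ≫ b}
  comp_mem {W X Y} a f hf := by
    induction hf using AddSubgroup.closure_induction with
    | mem x hx =>
      obtain ⟨X', Y', a', s, b, hs, rfl⟩ := hx
      exact AddSubgroup.subset_closure ⟨X', Y', a ≫ a', s, b, hs, by simp⟩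
    | zero => simp
    | add x y _ _ hx hy => simpa using add_mem hx hy
    | neg x _ hx => simpa using hx
  mem_comp {X Y Z} f b hf := by
    induction hf using AddSubgroup.closure_induction with
    | mem x hx =>
      obtain ⟨X', Y', a', s, b', hs, rfl⟩ := hx
      exact AddSubgroup.subset_closure ⟨X', Y', a', s, b' ≫ b, hs, by simp⟩
    | zero => simp
    | add x y _ _ hx hy => simpa using add_mem hx hy
    | neg x _ hx => simpa using hx

/-- The product `I J`: finite sums of `± g ∘ f` with `g` in `I` and `f` in `J`. -/
def mul (I J : CatIdeal C) : CatIdeal C where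
  hom X Y := AddSubgroup.closure
    {h | ∃ (Z : C) (f : X ⟶ Z) (g : Z ⟶ Y), f ∈ J.hom X Z ∧ g ∈ I.hom Z Y ∧ h = f ≫ g}
  comp_mem {W X Y} a f hf := by
    induction hf using AddSubgroup.closure_induction with
    | mem x hx =>
      obtain ⟨Z, f, g, hf, hg, rfl⟩ := hx
      exact AddSubgroup.subset_closure ⟨Z, a ≫ f, g, J.comp_mem a hf, hg, by simp⟩
    | zero => simp
    | add x y _ _ hx hy => simpa using add_mem hx hy
    | neg x _ hx => simpa using hx
  mem_comp {X Y Z} f b hf := by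
    induction hf using AddSubgroup.closure_induction with
    | mem x hx =>
      obtain ⟨Z', f, g, hf, hg, rfl⟩ := hx
      exact AddSubgroup.subset_closure ⟨Z', f, g ≫ b, hf, I.mem_comp b hg, by simp⟩
    | zero => simp
    | add x y _ _ hx hy => simpa using add_mem hx hy
    | neg x _ hx => simpa using hx

/-- Finite powers `I ^ n` of an ideal; `I ^ 0` is the ideal of all morphisms. -/
def pow (I : CatIdeal C) : ℕ → CatIdeal C
  | 0 => all
  | n + 1 => mul (pow I n) I

theorem all_mul (I : CatIdeal C) : mul all I = I := by
  ext X Y h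
  constructor
  · intro hh
    refine (AddSubgroup.closure_le (I.hom X Y)).2 ?_ hh
    rintro _ ⟨Z, f, g, hf, _, rfl⟩
    exact I.mem_comp g hf
  · intro hh
    exact AddSubgroup.subset_closure ⟨Y, h, 𝟙 Y, hh, trivial, by simp⟩

end CatIdeal

/-! ### The radical and its transfinite powers -/

section Radical

variable (C : Type u) [Category.{v} C] [Preadditive C] [HasBinaryBiproducts C]

/-- The radical: the ideal generated by the non-invertible morphisms between indecomposable
objects. -/
def catRad : CatIdeal C :=
  CatIdeal.generate fun X Y => {f | Indecomposable X ∧ Indecomposable Y ∧ ¬ IsIso f}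

/-- Auxiliary recursion for the powers of the radical. The second component is the power
`rad ^ α`; the first one is the ideal by which one multiplies at successor steps, namely `rad`
below `ω`, and `rad ^ μ` at `μ + n` for a limit ordinal `μ`. -/
def radPowAux (α : Ordinal.{w}) : CatIdeal C × CatIdeal C :=
  Ordinal.limitRecOn α (catRad C, CatIdeal.all)
    (fun _ p => (p.1, CatIdeal.mul p.2 p.1))
    (fun μ _ p =>
      (CatIdeal.inter fun β : Set.Iio μ => (p β.1 β.2).2,
        CatIdeal.inter fun β : Set.Iio μ => (p β.1 β.2).2))

/-- The transfinite powers of the radical; the rules that determine them are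
`radPow_natCast`, `radPow_limit` and `radPow_limit_add` below. -/
def radPow (α : Ordinal.{w}) : CatIdeal C := (radPowAux C α).2

theorem radPow_natCast (n : ℕ) : radPow C (n : Ordinal.{w}) = (catRad C).pow n := by
  have h : radPowAux C (n : Ordinal.{w}) = (catRad C, (catRad C).pow n) := by
    induction n with
    | zero => simp [radPowAux, CatIdeal.pow, Ordinal.limitRecOn_zero]
    | succ n ih =>
      rw [Nat.cast_succ]
      unfold radPowAux at ih ⊢
      rw [Ordinal.limitRecOn_add_one, ih]
      rfl
  rw [radPow, h]

theorem radPowAux_limit {μ : Ordinal.{w}} (hμ : Order.IsSuccLimit μ) :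
    radPowAux C μ = (CatIdeal.inter fun β : Set.Iio μ => radPow C β.1,
      CatIdeal.inter fun β : Set.Iio μ => radPow C β.1) := by
  unfold radPowAux
  rw [Ordinal.limitRecOn_limit _ _ _ _ hμ]
  rfl

/-- `rad ^ μ` is the intersection of the `rad ^ β`, `β < μ`, if `μ` is a limit ordinal. -/
theorem radPow_limit {μ : Ordinal.{w}} (hμ : Order.IsSuccLimit μ) :
    radPow C μ = CatIdeal.inter fun β : Set.Iio μ => radPow C β.1 := by
  rw [radPow, radPowAux_limit C hμ]

/-- `rad ^ (μ + n) = (rad ^ μ) ^ (n + 1)` if `μ` is a limit ordinal and `n` is finite. -/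
theorem radPow_limit_add {μ : Ordinal.{w}} (hμ : Order.IsSuccLimit μ) (n : ℕ) :
    radPow C (μ + n) = (radPow C μ).pow (n + 1) := by
  have h : radPowAux C (μ + n) = (radPow C μ, (radPow C μ).pow (n + 1)) := by
    induction n with
    | zero =>
      rw [Nat.cast_zero, add_zero, radPowAux_limit C hμ, ← radPow_limit C hμ]
      simp [CatIdeal.pow, CatIdeal.all_mul]
    | succ n ih =>
      rw [Nat.cast_succ, ← add_assoc]
      unfold radPowAux at ih ⊢
      rw [Ordinal.limitRecOn_add_one, ih]
      rfl
  rw [radPow, h]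

end Radical

/-! ### Finitely generated modules have binary biproducts -/

instance FGModuleCat.hasBinaryBiproducts_of_ring (R : Type u) [Ring R] :
    HasBinaryBiproducts (FGModuleCat.{v} R) where
  has_binary_biproduct M N :=
    hasBinaryBiproduct_of_total
      { pt := FGModuleCat.of R (M × N)
        fst := FGModuleCat.ofHom (LinearMap.fst R M N)
        snd := FGModuleCat.ofHom (LinearMap.snd R M N)
        inl := FGModuleCat.ofHom (LinearMap.inl R M N)
        inr := FGModuleCat.ofHom (LinearMap.inr R M N)
        inl_fst := by ext x; rfl
        inl_snd := by ext x; rfl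
        inr_fst := by ext x; rfl
        inr_snd := by ext x; rfl }
      (by
        refine FGModuleCat.hom_ext (LinearMap.ext fun (x : M × N) => ?_)
        change ((x.1, 0) + (0, x.2) : M × N) = x
        simp)

/-! ### The push-down functor to the skew group algebra

The skew group algebra `ΛG` is Mathlib's `SkewMonoidAlgebra Λ G`: the element `l ⊗ h` is
`SkewMonoidAlgebra.single h l`, and `(l ⊗ g) (m ⊗ h) = l g(m) ⊗ g h`. -/

section Pushdown

variable (Λ : Type u) [Ring Λ] (G : Type w) [Group G] [MulSemiringAction G Λ]

/-- The underlying group of the push-down of `M`: the direct sum of copies of `M` indexed by the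
finite group `G`. The copy at `k` stands for `k ⊗ M` in `ΛG ⊗_Λ M`. An element `e` of `Λ` acts on
it by `k⁻¹(e)`, so for a vertex `x` of a quiver with path algebra (modulo relations) `Λ` one has
`e_x (PushdownObj G M) = ⨁ k, M(k⁻¹ x)`. -/
def PushdownObj (M : Type v) : Type (max v w) := G → M

variable (M : Type v) [AddCommGroup M] [Module Λ M]

instance : AddCommGroup (PushdownObj G M) := inferInstanceAs (AddCommGroup (G → M))

/-- The action of the skew group algebra:
`((l ⊗ h) φ) k = k⁻¹(l) φ(h⁻¹ k)`, extended additively. -/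
instance : SMul (SkewMonoidAlgebra Λ G) (PushdownObj G M) where
  smul a φ := fun k => a.sum fun h l => (k⁻¹ • l) • (φ (h⁻¹ * k) : M)

variable {Λ G M}

theorem PushdownObj.smul_apply (a : SkewMonoidAlgebra Λ G) (φ : PushdownObj G M) (k : G) :
    (a • φ) k = a.sum fun h l => (k⁻¹ • l) • (φ (h⁻¹ * k) : M) := rfl

@[simp]
theorem PushdownObj.single_smul_apply (h : G) (l : Λ) (φ : PushdownObj G M) (k : G) :
    (SkewMonoidAlgebra.single h l • φ) k = (k⁻¹ • l) • (φ (h⁻¹ * k) : M) := by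
  rw [PushdownObj.smul_apply, SkewMonoidAlgebra.sum_single_index]
  simp

theorem PushdownObj.add_smul' (a b : SkewMonoidAlgebra Λ G) (φ : PushdownObj G M) :
    (a + b) • φ = a • φ + b • φ := by
  funext k
  change _ = (a • φ) k + (b • φ) k
  simp only [PushdownObj.smul_apply]
  exact SkewMonoidAlgebra.sum_add_index' (by simp) (by simp [add_smul])

theorem PushdownObj.smul_add' (a : SkewMonoidAlgebra Λ G) (φ ψ : PushdownObj G M) :
    a • (φ + ψ) = a • φ + a • ψ := by
  funext k
  change _ = (a • φ) k + (a • ψ) k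
  simp only [PushdownObj.smul_apply]
  rw [← SkewMonoidAlgebra.sum_add]
  exact SkewMonoidAlgebra.sum_congr fun x _ => smul_add _ _ _

instance : Module (SkewMonoidAlgebra Λ G) (PushdownObj G M) where
  one_smul φ := by
    funext k
    rw [SkewMonoidAlgebra.one_def, PushdownObj.single_smul_apply]
    simp
  zero_smul φ := by
    funext k
    rw [PushdownObj.smul_apply, SkewMonoidAlgebra.sum_zero_index]
    rfl
  smul_zero a := by
    have h := PushdownObj.smul_add' a (0 : PushdownObj G M) 0
    simpa using h
  smul_add := PushdownObj.smul_add'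
  add_smul := PushdownObj.add_smul'
  mul_smul a b φ := by
    induction a using SkewMonoidAlgebra.induction_on with
    | zero =>
      have h0 : ∀ χ : PushdownObj G M, (0 : SkewMonoidAlgebra Λ G) • χ = 0 := fun χ => by
        simpa using PushdownObj.add_smul' (0 : SkewMonoidAlgebra Λ G) 0 χ
      rw [zero_mul, h0, h0]
    | add a a' ha ha' => rw [add_mul, PushdownObj.add_smul', ha, ha', PushdownObj.add_smul']
    | single g l =>
      induction b using SkewMonoidAlgebra.induction_on with
      | zero =>
        have h0 : ∀ χ : PushdownObj G M, (0 : SkewMonoidAlgebra Λ G) • χ = 0 := fun χ => by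
          simpa using PushdownObj.add_smul' (0 : SkewMonoidAlgebra Λ G) 0 χ
        have h1 : ∀ a : SkewMonoidAlgebra Λ G, a • (0 : PushdownObj G M) = 0 := fun a => by
          simpa using PushdownObj.smul_add' a (0 : PushdownObj G M) 0
        rw [mul_zero, h0, h1]
      | add b b' hb hb' =>
        rw [mul_add, PushdownObj.add_smul', hb, hb', PushdownObj.add_smul', PushdownObj.smul_add']
      | single h m =>
        funext k
        rw [SkewMonoidAlgebra.single_mul_single]
        simp [smul_smul, mul_assoc]

open Classical in
/-- The element `1 ⊗ m` of the push-down of `M`. -/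
def PushdownObj.incl (m : M) : PushdownObj G M := Pi.single (1 : G) m

theorem PushdownObj.incl_apply_one (m : M) : (incl m : PushdownObj G M) 1 = m := by
  classical exact Pi.single_eq_same (M := fun _ : G => M) 1 m

theorem PushdownObj.incl_apply_of_ne (m : M) {k : G} (hk : k ≠ 1) :
    (incl m : PushdownObj G M) k = 0 := by
  classical exact Pi.single_eq_of_ne (M := fun _ : G => M) hk m

theorem PushdownObj.incl_add (m n : M) :
    (incl (m + n) : PushdownObj G M) = incl m + incl n := by
  classical exact Pi.single_add (f := fun _ : G => M) 1 m n

theorem PushdownObj.incl_smul (l : Λ) (m : M) :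
    (incl (l • m) : PushdownObj G M) = SkewMonoidAlgebra.single (1 : G) l • incl m := by
  classical
  funext k
  by_cases hk : k = 1
  · subst hk
    simp [incl_apply_one]
  · simp [incl_apply_of_ne _ hk]

theorem PushdownObj.sum_incl [Fintype G] (φ : PushdownObj G M) :
    ∑ k : G, SkewMonoidAlgebra.single k (1 : Λ) • (incl (φ k : M) : PushdownObj G M) = φ := by
  classical
  funext j
  have h : (∑ k : G, SkewMonoidAlgebra.single k (1 : Λ) • (incl (φ k : M) : PushdownObj G M)) j
      = ∑ k : G, (SkewMonoidAlgebra.single k (1 : Λ) • (incl (φ k : M) : PushdownObj G M)) j :=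
    Finset.sum_apply (M := fun _ : G => M) j _ _
  rw [h, Finset.sum_eq_single j]
  · simp [incl_apply_one]
  · intro k _ hk
    have : k⁻¹ * j ≠ 1 := fun h => hk (inv_mul_eq_one.1 h)
    simp [incl_apply_of_ne _ this]
  · simp

/-- The universal property of the induced module `ΛG ⊗_Λ M`: for a finite group `G`, every
`Λ`-linear map from `M` to a `ΛG`-module extends uniquely to the push-down of `M`. -/
theorem PushdownObj.existsUnique_extend [Finite G] {X : Type*} [AddCommGroup X]
    [Module (SkewMonoidAlgebra Λ G) X] (f : M →+ X)
    (hf : ∀ (l : Λ) (m : M), f (l • m) = SkewMonoidAlgebra.single (1 : G) l • f m) :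
    ∃! F : PushdownObj G M →ₗ[SkewMonoidAlgebra Λ G] X, ∀ m, F (incl m) = f m := by
  classical
  have := Fintype.ofFinite G
  have hadd : ∀ φ ψ : PushdownObj G M,
      ∑ k : G, SkewMonoidAlgebra.single k (1 : Λ) • f ((φ + ψ) k) =
        (∑ k : G, SkewMonoidAlgebra.single k (1 : Λ) • f (φ k)) +
          ∑ k : G, SkewMonoidAlgebra.single k (1 : Λ) • f (ψ k) := by
    intro φ ψ
    rw [← Finset.sum_add_distrib]
    refine Finset.sum_congr rfl fun k _ => ?_
    rw [← smul_add, ← map_add]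
    rfl
  refine ⟨
    { toFun := fun φ => ∑ k : G, SkewMonoidAlgebra.single k (1 : Λ) • f (φ k)
      map_add' := hadd
      map_smul' := ?_ }, ?_, ?_⟩
  · intro a φ
    simp only [RingHom.id_apply]
    induction a using SkewMonoidAlgebra.induction_on with
    | zero =>
      rw [zero_smul, zero_smul]
      refine Finset.sum_eq_zero fun k _ => ?_
      change _ • f 0 = 0
      simp
    | add a b ha hb => rw [add_smul, add_smul, hadd, ha, hb]
    | single h l =>
      rw [Finset.smul_sum, ← Equiv.sum_comp (Equiv.mulLeft h)]
      refine Finset.sum_congr rfl fun k _ => ?_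
      rw [PushdownObj.single_smul_apply, hf, ← mul_smul, ← mul_smul,
        SkewMonoidAlgebra.single_mul_single, SkewMonoidAlgebra.single_mul_single]
      simp [smul_smul]
  · intro m
    change ∑ k : G, SkewMonoidAlgebra.single k (1 : Λ) • f ((incl m : PushdownObj G M) k) = f m
    rw [Finset.sum_eq_single 1]
    · simp [incl_apply_one]
    · intro k _ hk
      simp [incl_apply_of_ne _ hk]
    · simp
  · intro F hF
    ext φ
    conv_lhs => rw [← PushdownObj.sum_incl (Λ := Λ) φ]
    rw [map_sum]
    simp only [map_smul, hF]
    rfl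

instance [Finite G] [Module.Finite Λ M] :
    Module.Finite (SkewMonoidAlgebra Λ G) (PushdownObj G M) := by
  have := Fintype.ofFinite G
  obtain ⟨S, hS⟩ := Module.Finite.fg_top (R := Λ) (M := M)
  classical
  refine ⟨⟨S.image PushdownObj.incl, ?_⟩⟩
  have key : ∀ m : M, (PushdownObj.incl m : PushdownObj G M) ∈ Submodule.span
      (SkewMonoidAlgebra Λ G) ((S.image PushdownObj.incl : Finset (PushdownObj G M)) : Set _) := by
    intro m
    have hm : m ∈ Submodule.span Λ (S : Set M) := hS ▸ Submodule.mem_top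
    induction hm using Submodule.span_induction with
    | mem x hx => exact Submodule.subset_span (by simpa using ⟨x, hx, rfl⟩)
    | zero =>
      have h := PushdownObj.incl_add (G := G) (0 : M) 0
      rw [add_zero, left_eq_add] at h
      rw [h]
      exact zero_mem _
    | add x y _ _ hx hy => rw [PushdownObj.incl_add]; exact add_mem hx hy
    | smul l x _ hx => rw [PushdownObj.incl_smul]; exact Submodule.smul_mem _ _ hx
  refine eq_top_iff.2 fun φ _ => ?_
  rw [← PushdownObj.sum_incl (Λ := Λ) φ]
  exact Submodule.sum_mem _ fun k _ => Submodule.smul_mem _ _ (key _)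

/-- The push-down of a `Λ`-linear map acts componentwise, that is, it is `id ⊗ f`. -/
def PushdownObj.map {N : Type v} [AddCommGroup N] [Module Λ N] (f : M →ₗ[Λ] N) :
    PushdownObj G M →ₗ[SkewMonoidAlgebra Λ G] PushdownObj G N where
  toFun φ := fun k => f (φ k)
  map_add' φ ψ := by
    funext k
    exact map_add f (φ k) (ψ k)
  map_smul' a φ := by
    funext k
    simp only [RingHom.id_apply, PushdownObj.smul_apply]
    rw [SkewMonoidAlgebra.map_sum]
    simp only [map_smul]
    rfl

variable (Λ G)

/-- The push-down functor `F_λ = ΛG ⊗_Λ - : mod Λ ⥤ mod ΛG`. -/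
def pushdown [Finite G] :
    FGModuleCat.{max v w} Λ ⥤ FGModuleCat.{max v w} (SkewMonoidAlgebra Λ G) where
  obj M := FGModuleCat.of (SkewMonoidAlgebra Λ G) (PushdownObj G M)
  map f := FGModuleCat.ofHom (PushdownObj.map f.hom.hom)
  map_id M := by
    ext φ
    rfl
  map_comp f g := by
    ext φ
    rfl

end Pushdown

end

/-!
The idea is that the push-down functor `F` and the restriction functor `H : mod ΛG ⥤ mod Λ` both
preserve the radical. Additive functors that preserve the radical preserve all its transfinite
powers (`CatIdeal.MapsTo.radPow`). Hence `f ∈ rad ^ α` implies `F f ∈ rad ^ α`; conversely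
`F f ∈ rad ^ β` implies `H F f ∈ rad ^ β`, and `f` is a direct summand of `H F f`, so `f ∈ rad ^ β`
(`mem_of_restr_pushdown_mem`). The case `β = α + 1` is the second assertion.

To see that the radical is preserved, it is identified with the Jacobson radical: `f` is in the
radical if and only if `1 - f g` is invertible for all `g` in the opposite direction
(`FGModuleCat.catRad_eq_catJacobson`). This uses that `Λ` and `ΛG` are Artinian rings, so that finitely
generated modules are finite direct sums of indecomposable modules with local endomorphism rings.

The Jacobson radical is preserved by full functors and reflected by functors that reflect
isomorphisms. Since `H` reflects isomorphisms, `F` preserves the radical as soon as `H F` does; and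
`H F f` is the direct sum of the twists of `f` by the elements of `G` (`sum_restrPushdown`), where the
twists are full functors. In the same way `F` reflects isomorphisms, and `F H f` is the
direct sum of the twists of `f` by the characters of `G` (`sum_pushdownRestr`). It is this last
decomposition that needs `G` abelian, `K` algebraically closed and `|G|` invertible: it amounts to the
orthogonality relation `sum_monoidHom_units_apply`.
-/

noncomputable section

/-! ### Ideals and additive functors -/

namespace CatIdeal

variable {C : Type u} [Category.{v} C] [Preadditive C]

/-- A functor maps the ideal `I` into the ideal `J`. -/
def MapsTo {D : Type*} [Category* D] [Preadditive D] (F : C ⥤ D) (I : CatIdeal C)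
    (J : CatIdeal D) : Prop :=
  ∀ ⦃X Y : C⦄ ⦃f : X ⟶ Y⦄, f ∈ I.hom X Y → F.map f ∈ J.hom (F.obj X) (F.obj Y)

variable {D : Type*} [Category* D] [Preadditive D] {F : C ⥤ D}

theorem MapsTo.mul [F.Additive] {I I' : CatIdeal C} {J J' : CatIdeal D}
    (h : MapsTo F I J) (h' : MapsTo F I' J') : MapsTo F (I.mul I') (J.mul J') := by
  intro X Y f hf
  refine AddSubgroup.closure_induction (fun x hx => ?_) (by simp) (fun x y _ _ hx hy => ?_)
    (fun x _ hx => ?_) hf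
  · obtain ⟨Z, a, b, ha, hb, rfl⟩ := hx
    exact AddSubgroup.subset_closure
      ⟨F.obj Z, F.map a, F.map b, h' ha, h hb, F.map_comp a b⟩
  · simpa using add_mem hx hy
  · simpa using hx

theorem MapsTo.inter {ι : Sort*} {I : ι → CatIdeal C} {J : ι → CatIdeal D}
    (h : ∀ i, MapsTo F (I i) (J i)) : MapsTo F (CatIdeal.inter I) (CatIdeal.inter J) :=
  fun _ _ _ hf => AddSubgroup.mem_iInf.2 fun i => h i (AddSubgroup.mem_iInf.1 hf i)

end CatIdeal

/-- An additive functor that maps the radical into the radical does so for all transfinite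
powers. -/
theorem CatIdeal.MapsTo.radPow {C : Type*} [Category* C] [Preadditive C] [HasBinaryBiproducts C]
    {D : Type*} [Category* D] [Preadditive D] [HasBinaryBiproducts D] {F : C ⥤ D} [F.Additive]
    (h : CatIdeal.MapsTo F (catRad C) (catRad D)) (α : Ordinal.{w}) :
    CatIdeal.MapsTo F (radPow C α) (radPow D α) := by
  -- The induction carries along the ideal by which one multiplies at successor steps.
  suffices H : CatIdeal.MapsTo F (radPowAux C α).1 (radPowAux D α).1 ∧
      CatIdeal.MapsTo F (radPowAux C α).2 (radPowAux D α).2 from H.2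
  induction α using Ordinal.limitRecOn with
  | zero =>
    simp only [radPowAux, Ordinal.limitRecOn_zero]
    exact ⟨h, fun _ _ _ _ => trivial⟩
  | add_one α ih =>
    unfold radPowAux at ih ⊢
    rw [Ordinal.limitRecOn_add_one, Ordinal.limitRecOn_add_one]
    exact ⟨ih.1, ih.2.mul ih.1⟩
  | limit μ hμ ih =>
    rw [radPowAux_limit C hμ, radPowAux_limit D hμ]
    have := CatIdeal.MapsTo.inter fun β : Set.Iio μ => (ih β.1 β.2).2
    exact ⟨this, this⟩

/-! ### The Jacobson radical of a preadditive category -/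

section Jacobson

variable {C : Type u} [Category.{v} C] [Preadditive C]

/-- If `1 - f g` is invertible, then so is `1 - g f`. -/
theorem isIso_id_sub_comp_swap {X Y : C} (f : X ⟶ Y) (g : Y ⟶ X) [IsIso (𝟙 X - f ≫ g)] :
    IsIso (𝟙 Y - g ≫ f) := by
  obtain ⟨u, h₁, h₂⟩ := (inferInstance : IsIso (𝟙 X - f ≫ g))
  rw [Preadditive.sub_comp, Category.id_comp, Category.assoc, sub_eq_iff_eq_add'] at h₁
  rw [Preadditive.comp_sub, Category.comp_id, sub_eq_iff_eq_add'] at h₂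
  refine ⟨𝟙 Y + g ≫ u ≫ f, ?_, ?_⟩
  · have : g ≫ u ≫ f = g ≫ (f ≫ g ≫ u + 𝟙 X) ≫ f := by rw [← h₁]
    simp only [Preadditive.sub_comp, Preadditive.comp_add, Category.id_comp, Category.assoc,
      Preadditive.add_comp, Category.comp_id] at this ⊢
    nth_rw 1 [this]; abel
  · have : g ≫ u ≫ f = g ≫ (u ≫ f ≫ g + 𝟙 X) ≫ f := by rw [← h₂]
    simp only [Preadditive.comp_sub, Preadditive.comp_add, Category.id_comp, Category.assoc,
      Preadditive.add_comp, Category.comp_id] at this ⊢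
    rw [this]; abel

variable (C) in
/-- The Jacobson radical of a preadditive category: the morphisms `f : X ⟶ Y` such that
`1 - f g` is invertible for every `g : Y ⟶ X`. -/
def catJacobson : CatIdeal C where
  hom X Y :=
    { carrier := {f | ∀ g : Y ⟶ X, IsIso (𝟙 X - f ≫ g)}
      zero_mem' := fun g => by simpa using! (inferInstance : IsIso (𝟙 X))
      add_mem' := by
        intro f f' hf hf' g
        -- `1 - (f + f') g = (1 - f g) (1 - (1 - f g)⁻¹ f' g)`
        have := hf g
        have := hf' (g ≫ inv (𝟙 X - f ≫ g))
        rw [← Category.assoc] at this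
        have := isIso_id_sub_comp_swap (f' ≫ g) (inv (𝟙 X - f ≫ g))
        have key : 𝟙 X - (f + f') ≫ g =
            (𝟙 X - f ≫ g) ≫ (𝟙 X - inv (𝟙 X - f ≫ g) ≫ f' ≫ g) := by
          rw [Preadditive.comp_sub, IsIso.hom_inv_id_assoc]
          simp; abel
        rw [key]
        infer_instance
      neg_mem' := by
        intro f hf g
        simpa using hf (-g) }
  comp_mem {W X Y} a f hf g := by
    have := hf (g ≫ a)
    rw [← Category.assoc] at this
    simpa using isIso_id_sub_comp_swap (f ≫ g) a
  mem_comp b hf g := by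
    simpa using hf (b ≫ g)

variable {D : Type*} [Category* D] [Preadditive D]

/-- Full functors preserve the Jacobson radical, since every test morphism comes from the source. -/
theorem mapsTo_catJacobson_of_full (F : C ⥤ D) [F.Additive] [F.Full] :
    CatIdeal.MapsTo F (catJacobson C) (catJacobson D) := by
  intro X Y f hf g
  obtain ⟨g, rfl⟩ := F.map_surjective g
  have := hf g
  rw [← F.map_id, ← F.map_comp, ← F.map_sub]
  infer_instance

/-- A functor that reflects isomorphisms also reflects membership in the Jacobson radical. -/
theorem mem_catJacobson_of_map (F : C ⥤ D) [F.Additive] [F.ReflectsIsomorphisms] {X Y : C}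
    {f : X ⟶ Y} (hf : F.map f ∈ (catJacobson D).hom _ _) : f ∈ (catJacobson C).hom X Y := by
  intro g
  have := hf (F.map g)
  rw [← F.map_id, ← F.map_comp, ← F.map_sub] at this
  exact isIso_of_reflects_iso _ F

/-- In a category in which every object is a finite direct sum of indecomposable objects with
local endomorphism rings, the radical is the Jacobson radical. The decomposition is expressed by
saying that every identity is a sum of morphisms that factor through indecomposable objects. -/
theorem catRad_eq_catJacobson [HasBinaryBiproducts C]
    (hloc : ∀ X : C, Indecomposable X → ∀ φ : X ⟶ X, IsIso φ ∨ IsIso (𝟙 X - φ))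
    (hdec : ∀ X : C, 𝟙 X ∈ AddSubgroup.closure
      {h | ∃ (Y : C) (a : X ⟶ Y) (b : Y ⟶ X), Indecomposable Y ∧ h = a ≫ b}) :
    catRad C = catJacobson C := by
  ext X Y f
  constructor
  · intro hf
    refine (AddSubgroup.closure_le ((catJacobson C).hom X Y)).2 ?_ hf
    rintro _ ⟨X', Y', a, s, b, ⟨hX, hY, hs⟩, rfl⟩
    refine (catJacobson C).comp_mem a ((catJacobson C).mem_comp b fun g => ?_)
    obtain h | h := hloc X' hX (s ≫ g)
    · obtain h' | h' := hloc Y' hY (g ≫ s)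
      · have : IsSplitMono s := ⟨⟨⟨g ≫ inv (s ≫ g), by rw [← Category.assoc]; simp⟩⟩⟩
        have : IsSplitEpi s := ⟨⟨⟨inv (g ≫ s) ≫ g, by simp⟩⟩⟩
        exact absurd (isIso_of_mono_of_isSplitEpi s) hs
      · exact isIso_id_sub_comp_swap g s
    · exact h
  · intro hf
    have key : ∀ a : X ⟶ X, a ∈ AddSubgroup.closure
        {h | ∃ (Z : C) (a : X ⟶ Z) (b : Z ⟶ X), Indecomposable Z ∧ h = a ≫ b} →
        ∀ b : Y ⟶ Y, b ∈ AddSubgroup.closure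
        {h | ∃ (Z : C) (a : Y ⟶ Z) (b : Z ⟶ Y), Indecomposable Z ∧ h = a ≫ b} →
        a ≫ f ≫ b ∈ (catRad C).hom X Y := by
      intro a ha b hb
      induction ha using AddSubgroup.closure_induction with
      | zero => simp
      | add x y _ _ hx hy => simpa using add_mem hx hy
      | neg x _ hx => simpa using hx
      | mem a ha =>
        obtain ⟨Z, p, q, hZ, rfl⟩ := ha
        induction hb using AddSubgroup.closure_induction with
        | zero => simp
        | add x y _ _ hx hy => simpa using add_mem hx hy
        | neg x _ hx => simpa using hx
        | mem b hb =>
          obtain ⟨Z', p', q', hZ', rfl⟩ := hb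
          refine AddSubgroup.subset_closure
            ⟨Z, Z', p, q ≫ f ≫ p', q', ⟨hZ, hZ', fun hiso => hZ.1 ?_⟩, by simp⟩
          -- An isomorphism in the Jacobson radical with inverse `g` makes `1 - f g = 0` invertible.
          have := (catJacobson C).comp_mem q ((catJacobson C).mem_comp p' hf)
            (inv (q ≫ f ≫ p'))
          rw [IsIso.hom_inv_id, sub_self] at this
          exact (IsZero.iff_id_eq_zero Z).2 ((cancel_epi (0 : Z ⟶ Z)).1 (by simp))
    simpa using key _ (hdec X) _ (hdec Y)

end Jacobson

/-! ### The radical of the category of finitely generated modules over an Artinian ring -/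

namespace FGModuleCat

variable {A : Type u} [Ring A]

theorem isIso_iff_bijective {X Y : FGModuleCat.{v} A} (f : X ⟶ Y) :
    IsIso f ↔ Function.Bijective f.hom.hom := by
  constructor
  · intro h
    exact (isoToLinearEquiv (asIso f)).bijective
  · intro h
    exact (LinearEquiv.toFGModuleCatIso (LinearEquiv.ofBijective f.hom.hom h)).isIso_hom

theorem isZero_iff_subsingleton (X : FGModuleCat.{v} A) : IsZero X ↔ Subsingleton X := by
  rw [IsZero.iff_id_eq_zero]
  constructor
  · intro h
    have h' : ∀ x : X, x = 0 := fun x => congrArg (fun f : X ⟶ X => f.hom.hom x) h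
    exact ⟨fun x y => (h' x).trans (h' y).symm⟩
  · intro h
    ext x
    exact Subsingleton.elim _ _

/-- The categorical biproduct of two finitely generated modules is their product. -/
def prodIsoBiprod (X Y : FGModuleCat.{v} A) : FGModuleCat.of A (X × Y) ≅ X ⊞ Y :=
  biprod.uniqueUpToIso X Y (b :=
      { pt := FGModuleCat.of A (X × Y)
        fst := FGModuleCat.ofHom (LinearMap.fst A X Y)
        snd := FGModuleCat.ofHom (LinearMap.snd A X Y)
        inl := FGModuleCat.ofHom (LinearMap.inl A X Y)
        inr := FGModuleCat.ofHom (LinearMap.inr A X Y)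
        inl_fst := by ext x; rfl
        inl_snd := by ext x; rfl
        inr_fst := by ext x; rfl
        inr_snd := by ext x; rfl })
    (isBinaryBilimitOfTotal _ (by
      refine FGModuleCat.hom_ext (LinearMap.ext fun (x : X × Y) => ?_)
      change ((x.1, 0) + (0, x.2) : X × Y) = x
      simp))

variable [IsArtinianRing A]

/-- The endomorphism ring of an indecomposable module is local. By Fitting's lemma the module is the
direct sum of the kernel and the range of a high power of `φ`, so `φ` is bijective or nilpotent. -/
theorem isIso_or_isIso_id_sub {X : FGModuleCat.{v} A} (hX : Indecomposable X) (φ : X ⟶ X) :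
    IsIso φ ∨ IsIso (𝟙 X - φ) := by
  obtain ⟨n, hn, hcompl⟩ := ((Filter.eventually_ge_atTop 1).and
    (LinearMap.eventually_isCompl_ker_pow_range_pow (φ.hom.hom : Module.End A X))).exists
  set ψ : Module.End A X := φ.hom.hom with hψ
  obtain h | h := hX.2 (FGModuleCat.of A (LinearMap.ker (ψ ^ n)))
    (FGModuleCat.of A (LinearMap.range (ψ ^ n)))
    ((LinearEquiv.toFGModuleCatIso (Submodule.prodEquivOfIsCompl _ _ hcompl)).symm ≪≫
      prodIsoBiprod (FGModuleCat.of A (LinearMap.ker (ψ ^ n)))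
        (FGModuleCat.of A (LinearMap.range (ψ ^ n))))
  · left
    rw [isZero_iff_subsingleton] at h
    have hker : LinearMap.ker (ψ ^ n) = ⊥ := (Submodule.subsingleton_iff_eq_bot).1 h
    have hrange : LinearMap.range (ψ ^ n) = ⊤ := by
      rw [hker] at hcompl
      exact bot_sup_eq (LinearMap.range (ψ ^ n)) ▸ hcompl.sup_eq_top
    have hu : IsUnit (ψ ^ n) := (Module.End.isUnit_iff _).2
      ⟨LinearMap.ker_eq_bot.1 hker, LinearMap.range_eq_top.1 hrange⟩
    rw [isUnit_pow_iff (by lia), Module.End.isUnit_iff] at hu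
    exact (isIso_iff_bijective φ).2 hu
  · right
    rw [isZero_iff_subsingleton] at h
    have hrange : LinearMap.range (ψ ^ n) = ⊥ := (Submodule.subsingleton_iff_eq_bot).1 h
    have hnil : IsNilpotent ψ := ⟨n, LinearMap.range_eq_bot.1 hrange⟩
    exact (isIso_iff_bijective _).2 ((Module.End.isUnit_iff _).1 hnil.isUnit_one_sub)

/-- Every finitely generated module over an Artinian ring is a finite direct sum of indecomposable
modules, by induction on the length. -/
theorem id_mem_closure_indecomposable (X : FGModuleCat.{v} A) : 𝟙 X ∈ AddSubgroup.closure
    {h | ∃ (Y : FGModuleCat.{v} A) (a : X ⟶ Y) (b : Y ⟶ X), Indecomposable Y ∧ h = a ≫ b} := by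
  induction hn : Module.length A X using WellFoundedLT.induction generalizing X with
  | ind n ih =>
  by_cases h0 : IsZero X
  · rw [(IsZero.iff_id_eq_zero X).1 h0]
    exact zero_mem _
  by_cases hX : Indecomposable X
  · exact AddSubgroup.subset_closure ⟨X, 𝟙 X, 𝟙 X, hX, by simp⟩
  simp only [Indecomposable, not_and, not_forall, not_or] at hX
  obtain ⟨Y, Z, e, hY, hZ⟩ := hX h0
  have hlen : Module.length A X = Module.length A Y + Module.length A Z := by
    rw [← Module.length_prod]
    exact (isoToLinearEquiv (e ≪≫ (prodIsoBiprod Y Z).symm)).length_eq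
  rw [isZero_iff_subsingleton, not_subsingleton_iff_nontrivial] at hY hZ
  have hYpos := Module.length_pos (R := A) (M := Y)
  have hZpos := Module.length_pos (R := A) (M := Z)
  have hYtop := Module.length_ne_top (R := A) (M := Y)
  have hZtop := Module.length_ne_top (R := A) (M := Z)
  have lift : ∀ (W : FGModuleCat.{v} A) (i : X ⟶ W) (p : W ⟶ X), 𝟙 W ∈ AddSubgroup.closure
      {h | ∃ (Y : FGModuleCat.{v} A) (a : W ⟶ Y) (b : Y ⟶ W), Indecomposable Y ∧ h = a ≫ b} →
      i ≫ p ∈ AddSubgroup.closure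
      {h : X ⟶ X | ∃ (Y : FGModuleCat.{v} A) (a : X ⟶ Y) (b : Y ⟶ X),
        Indecomposable Y ∧ h = a ≫ b} := by
    intro W i p hW
    rw [← Category.id_comp p]
    generalize 𝟙 W = x at hW
    induction hW using AddSubgroup.closure_induction with
    | zero => simp
    | add x y _ _ hx hy => simpa using add_mem hx hy
    | neg x _ hx => simpa using hx
    | mem x hx =>
      obtain ⟨V, a, b, hV, rfl⟩ := hx
      exact AddSubgroup.subset_closure ⟨V, i ≫ a, b ≫ p, hV, by simp⟩
  have hsum : 𝟙 X = (e.hom ≫ biprod.fst) ≫ (biprod.inl ≫ e.inv) +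
      (e.hom ≫ biprod.snd) ≫ (biprod.inr ≫ e.inv) := by
    calc 𝟙 X = e.hom ≫ 𝟙 (Y ⊞ Z) ≫ e.inv := by simp
      _ = _ := by rw [← biprod.total]; simp only [Preadditive.add_comp, Preadditive.comp_add,
        Category.assoc]
  rw [hsum]
  refine add_mem (lift Y _ _ (ih _ ?_ Y rfl)) (lift Z _ _ (ih _ ?_ Z rfl))
  · rw [← hn, hlen]
    rw [add_comm]
    exact ENat.lt_add_left hYtop hZpos
  · rw [← hn, hlen]
    exact ENat.lt_add_left hZtop hYpos

/-- The category of finitely generated modules over an Artinian ring is a Krull–Schmidt category, so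
its radical is the Jacobson radical. -/
theorem catRad_eq_catJacobson : catRad (FGModuleCat.{v} A) = catJacobson (FGModuleCat.{v} A) :=
  _root_.catRad_eq_catJacobson (fun _ hX φ => isIso_or_isIso_id_sub hX φ)
    id_mem_closure_indecomposable

end FGModuleCat

/-! ### Restriction of scalars for finitely generated modules -/

namespace FGModuleCat

/-- The morphism of `FGModuleCat R` given by a linear map between the underlying modules of two
arbitrary objects. -/
abbrev homMk {R : Type u} [Ring R] {X Y : FGModuleCat.{v} R} (f : X →ₗ[R] Y) : X ⟶ Y :=
  ofHom f

theorem sum_apply {R : Type u} [Ring R] {X Y : FGModuleCat.{v} R} {ι : Type*} (s : Finset ι)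
    (f : ι → (X ⟶ Y)) (x : X) : (∑ i ∈ s, f i).hom.hom x = ∑ i ∈ s, (f i).hom.hom x := by
  classical
  induction s using Finset.induction_on with
  | empty => rfl
  | insert i s hi ih => rw [Finset.sum_insert hi, Finset.sum_insert hi, ← ih]; rfl

variable {A : Type u} [Ring A] {B : Type w} [Ring B]

/-- Restriction of scalars along a ring homomorphism `σ : A →+* B` such that `B` is a finitely
generated left `A`-module. -/
def restrictScalars (σ : A →+* B)
    (hσ : Module.Finite A ((ModuleCat.restrictScalars σ).obj (ModuleCat.of B B))) :
    FGModuleCat.{v} B ⥤ FGModuleCat.{v} A :=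
  (ModuleCat.isFG A).lift ((ModuleCat.isFG B).ι ⋙ ModuleCat.restrictScalars σ) fun M => by
    let _ : Module A B := Module.compHom B σ
    let _ : Module A M := Module.compHom M σ
    have _ : IsScalarTower A B M := ⟨fun a b m => mul_smul (σ a) b m⟩
    have _ : Module.Finite A B := hσ
    exact Module.Finite.trans (R := A) B M

variable (σ : A →+* B)
  (hσ : Module.Finite A ((ModuleCat.restrictScalars σ).obj (ModuleCat.of B B)))

instance : (restrictScalars.{u, v} σ hσ).Additive where
  map_add := rfl

instance : (restrictScalars.{u, v} σ hσ).ReflectsIsomorphisms where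
  reflects f h := (isIso_iff_bijective f).2 ((isIso_iff_bijective ((restrictScalars σ hσ).map f)).1 h)

theorem restrictScalars_full (h : Function.Surjective σ) : (restrictScalars.{u, v} σ hσ).Full where
  map_surjective {X Y} g :=
    ⟨FGModuleCat.ofHom (V := X) (W := Y)
      { toFun := g.hom.hom
        map_add' := map_add g.hom.hom
        map_smul' := fun b x => by
          obtain ⟨a, rfl⟩ := h b
          exact g.hom.hom.map_smul a x }, rfl⟩

theorem finite_of_surjective (h : Function.Surjective σ) :
    Module.Finite A ((ModuleCat.restrictScalars σ).obj (ModuleCat.of B B)) :=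
  Module.Finite.of_surjective
    (P := (ModuleCat.restrictScalars σ).obj (ModuleCat.of B B)) (σ := RingHom.id A)
    { toFun := σ
      map_add' := map_add σ
      map_smul' := map_mul σ } h

end FGModuleCat

/-! ### Restriction to `Λ` of modules over the skew group algebra -/

namespace SkewMonoidAlgebra

theorem finite_self (Λ : Type u) [Ring Λ] (G : Type w) [Finite G] :
    Module.Finite Λ (SkewMonoidAlgebra Λ G) :=
  Module.Finite.equiv (coeffLinearEquiv (S := Λ) (k := Λ) (G := G)).symm

section Ring

variable (Λ : Type u) [Ring Λ] (G : Type w) [Group G] [MulSemiringAction G Λ]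

theorem isArtinianRing [Finite G] [IsArtinianRing Λ] : IsArtinianRing (SkewMonoidAlgebra Λ G) :=
  have := finite_self Λ G
  IsArtinianRing.of_finite Λ _

theorem finite_singleOneRingHom [Finite G] :
    Module.Finite Λ ((ModuleCat.restrictScalars (singleOneRingHom (k := Λ) (G := G))).obj
      (ModuleCat.of (SkewMonoidAlgebra Λ G) (SkewMonoidAlgebra Λ G))) := by
  have := finite_self Λ G
  refine Module.Finite.of_surjective (M := SkewMonoidAlgebra Λ G)
    (P := (ModuleCat.restrictScalars (singleOneRingHom (k := Λ) (G := G))).obj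
      (ModuleCat.of (SkewMonoidAlgebra Λ G) (SkewMonoidAlgebra Λ G))) (σ := RingHom.id Λ)
    { toFun := fun a => a
      map_add' := fun _ _ => rfl
      map_smul' := fun l a => ?_ } Function.surjective_id
  change l • a = single 1 l * a
  conv_lhs => rw [← one_mul a, ← smul_mul_assoc, one_def, smul_single, smul_eq_mul, mul_one]

/-- The restriction functor `mod ΛG ⥤ mod Λ`, adjoint on both sides to the push-down. -/
def restr [Finite G] : FGModuleCat.{v} (SkewMonoidAlgebra Λ G) ⥤ FGModuleCat.{v} Λ :=
  FGModuleCat.restrictScalars (singleOneRingHom (k := Λ) (G := G)) (finite_singleOneRingHom Λ G)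

instance [Finite G] : (restr.{u, v} Λ G).Additive := by unfold restr; infer_instance

instance [Finite G] : (restr.{u, v} Λ G).ReflectsIsomorphisms := by unfold restr; infer_instance

variable {Λ G}

/-- An additive map that commutes with the elements `l ⊗ h` is linear over the skew group
algebra. -/
def linearMapOfSingle {X Y : Type*} [AddCommGroup X] [Module (SkewMonoidAlgebra Λ G) X]
    [AddCommGroup Y] [Module (SkewMonoidAlgebra Λ G) Y] (f : X → Y)
    (hadd : ∀ x y, f (x + y) = f x + f y)
    (hf : ∀ (h : G) (l : Λ) (x : X), f (single h l • x) = single h l • f x) :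
    X →ₗ[SkewMonoidAlgebra Λ G] Y where
  toFun := f
  map_add' := hadd
  map_smul' a x := by
    rw [RingHom.id_apply]
    induction a using SkewMonoidAlgebra.induction_on with
    | zero => simpa using hadd 0 0
    | add a b ha hb => rw [add_smul, hadd, ha, hb, add_smul]
    | single h l => exact hf h l x

end Ring

/-! ### Twisting by a character -/

section Twist

variable {K : Type v} [Field K] {Λ : Type u} [Ring Λ] [Algebra K Λ]
  {G : Type w} [Group G] [MulSemiringAction G Λ] [SMulCommClass G K Λ]

/-- The automorphism `l ⊗ h ↦ χ(h) l ⊗ h` of the skew group algebra given by a character `χ`. -/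
def twist (χ : G →* Kˣ) : SkewMonoidAlgebra Λ G →+* SkewMonoidAlgebra Λ G :=
  liftNCRingHom singleOneRingHom
    { toFun := fun h => single h ((χ h : K) • (1 : Λ))
      map_one' := by simp
      map_mul' := fun g h => by
        rw [single_mul_single, smul_comm g, smul_one, map_mul, Units.val_mul, mul_smul_comm,
          mul_one, smul_smul, mul_comm] }
    (by
      intro x y
      change single 1 (y • x) * single y _ = single y _ * single 1 x
      simp [single_mul_single])

theorem twist_single (χ : G →* Kˣ) (h : G) (l : Λ) :
    twist χ (single h l) = single h ((χ h : K) • l) := by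
  refine (liftNC_single _ _ _ _).trans ?_
  change single 1 l * single h ((χ h : K) • (1 : Λ)) = _
  simp [single_mul_single]

theorem twist_surjective (χ : G →* Kˣ) : Function.Surjective (twist (Λ := Λ) χ) := by
  intro a
  induction a using SkewMonoidAlgebra.induction_on with
  | zero => exact ⟨0, map_zero _⟩
  | add a b ha hb =>
    obtain ⟨a, rfl⟩ := ha
    obtain ⟨b, rfl⟩ := hb
    exact ⟨a + b, map_add _ _ _⟩
  | single h l =>
    exact ⟨single h (((χ h)⁻¹ : Kˣ) • l), by
      rw [twist_single]; congr 1; exact smul_inv_smul (χ h) l⟩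

end Twist

end SkewMonoidAlgebra

/-- The orthogonality relation for the characters of a finite abelian group. -/
theorem sum_monoidHom_units_apply {K : Type*} [Field K] [IsAlgClosed K] {G : Type*} [CommGroup G]
    [Finite G] (hG : (Nat.card G : K) ≠ 0) [Fintype (G →* Kˣ)] [DecidableEq G] (g : G) :
    ∑ χ : G →* Kˣ, (χ g : K) = if g = 1 then (Nat.card G : K) else 0 := by
  have : NeZero ((Monoid.exponent G : ℕ) : K) := ⟨fun h => hG (by
    obtain ⟨m, hm⟩ := Group.exponent_dvd_nat_card (G := G)
    rw [hm, Nat.cast_mul, h, zero_mul])⟩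
  split_ifs with hg
  · subst hg
    simp [← Nat.card_eq_fintype_card, CommGroup.card_monoidHom_of_hasEnoughRootsOfUnity]
  · obtain ⟨ψ, hψ⟩ := CommGroup.exists_apply_ne_one_of_hasEnoughRootsOfUnity G K hg
    -- Multiplication by `ψ` permutes the characters, so the sum is fixed by the factor `ψ g ≠ 1`.
    have h : (ψ g : K) * ∑ χ : G →* Kˣ, (χ g : K) = ∑ χ : G →* Kˣ, (χ g : K) := by
      rw [Finset.mul_sum]
      exact Fintype.sum_equiv (Equiv.mulLeft ψ) _ _ fun χ => by simp
    by_contra h0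
    exact hψ (Units.ext (mul_right_cancel₀ h0 (h.trans (one_mul _).symm)))

open SkewMonoidAlgebra

/-! ### The push-down functor and the radical -/

section Pushdown

variable (Λ : Type u) [Ring Λ] (G : Type w) [Group G] [Finite G] [MulSemiringAction G Λ]

instance : (pushdown.{u, v} Λ G).Additive where
  map_add := rfl

instance : (pushdown.{u, v} Λ G).ReflectsIsomorphisms where
  reflects {M N} f h := by
    rw [FGModuleCat.isIso_iff_bijective] at h ⊢
    refine ⟨fun m n hmn => ?_, fun n => ?_⟩
    · exact congrFun (h.1 (a₁ := fun _ : G => m) (a₂ := fun _ : G => n)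
        (funext fun _ => hmn)) 1
    · obtain ⟨φ, hφ⟩ := h.2 fun _ : G => n
      exact ⟨φ 1, congrFun hφ 1⟩

/-- Restriction of a `Λ`-module along the automorphism `l ↦ k⁻¹(l)`. -/
def groupTwist (k : G) : FGModuleCat.{v} Λ ⥤ FGModuleCat.{v} Λ :=
  FGModuleCat.restrictScalars (MulSemiringAction.toRingHom G Λ k⁻¹)
    (FGModuleCat.finite_of_surjective _ (MulAction.surjective k⁻¹))

instance (k : G) : (groupTwist.{u, v} Λ G k).Additive := by unfold groupTwist; infer_instance

instance (k : G) : (groupTwist.{u, v} Λ G k).Full :=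
  FGModuleCat.restrictScalars_full _ _ (MulAction.surjective k⁻¹)

variable {Λ G}

theorem smul_restr_pushdown_apply (M : FGModuleCat.{max v w} Λ) (l : Λ)
    (φ : (restr Λ G).obj ((pushdown.{u, v} Λ G).obj M)) (k : G) :
    (show G → M from l • φ) k = (k⁻¹ • l) • (show G → M from φ) k := by
  refine (PushdownObj.single_smul_apply (1 : G) l (show PushdownObj G M from φ) k).trans ?_
  rw [inv_one, one_mul]

/-- The projection of the restricted push-down of `M` onto its component at `k`. -/
def restrPushdownProj (k : G) (M : FGModuleCat.{max v w} Λ) :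
    (restr Λ G).obj ((pushdown.{u, v} Λ G).obj M) ⟶ (groupTwist Λ G k).obj M :=
  FGModuleCat.homMk (X := (restr Λ G).obj ((pushdown.{u, v} Λ G).obj M))
    (Y := (groupTwist Λ G k).obj M)
    { toFun := fun φ => (show G → M from φ) k
      map_add' := fun _ _ => rfl
      map_smul' := fun l φ => smul_restr_pushdown_apply M l φ k }

/-- The inclusion of the component at `k` into the restricted push-down of `M`. -/
def restrPushdownIncl [DecidableEq G] (k : G) (M : FGModuleCat.{max v w} Λ) :
    (groupTwist Λ G k).obj M ⟶ (restr Λ G).obj ((pushdown.{u, v} Λ G).obj M) :=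
  FGModuleCat.homMk (X := (groupTwist Λ G k).obj M)
    (Y := (restr Λ G).obj ((pushdown.{u, v} Λ G).obj M))
    { toFun := fun m => (Pi.single k (show M from m) : G → M)
      map_add' := fun m n => Pi.single_add (f := fun _ : G => (M : Type _)) k m n
      map_smul' := fun l m => by
        refine funext fun j => Eq.trans ?_ (smul_restr_pushdown_apply M l _ j).symm
        change (Pi.single k ((k⁻¹ • l) • (show M from m)) : G → M) j =
          (j⁻¹ • l) • (Pi.single k (show M from m) : G → M) j
        obtain rfl | hj := eq_or_ne j k
        · rw [Pi.single_eq_same, Pi.single_eq_same]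
        · rw [Pi.single_eq_of_ne hj, Pi.single_eq_of_ne hj, smul_zero] }

/-- The restriction of the push-down of `f` is the direct sum of the translates of `f`. -/
theorem sum_restrPushdown [Fintype G] [DecidableEq G] {M N : FGModuleCat.{max v w} Λ} (f : M ⟶ N) :
    (restr Λ G).map ((pushdown.{u, v} Λ G).map f) =
      ∑ k : G, restrPushdownProj k M ≫ (groupTwist Λ G k).map f ≫ restrPushdownIncl k N := by
  refine FGModuleCat.hom_ext (LinearMap.ext fun φ => ?_)
  rw [FGModuleCat.sum_apply]
  refine (Finset.univ_sum_single (M := fun _ : G => (N : Type _))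
    (fun k => f.hom.hom ((show G → M from φ) k))).symm.trans ?_
  rfl

/-- The push-down functor maps the Jacobson radical into the Jacobson radical. It suffices
to check this after restriction to `Λ`, where the push-down of `f` becomes the direct sum of the
translates of `f`. -/
theorem mapsTo_catJacobson_pushdown :
    CatIdeal.MapsTo (pushdown.{u, v} Λ G) (catJacobson (FGModuleCat.{max v w} Λ))
      (catJacobson (FGModuleCat.{max v w} (SkewMonoidAlgebra Λ G))) := by
  classical
  have := Fintype.ofFinite G
  intro M N f hf
  refine mem_catJacobson_of_map (restr Λ G) ?_
  rw [sum_restrPushdown]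
  exact sum_mem fun k _ => CatIdeal.comp_mem _ _ (CatIdeal.mem_comp _ _
    (mapsTo_catJacobson_of_full (groupTwist Λ G k) hf))

/-- The unit `m ↦ 1 ⊗ m` and the projection to the component at `1` show that `f` is a direct summand
of the restriction of its push-down; hence an ideal contains `f` if it contains the latter. -/
theorem mem_of_restr_pushdown_mem (I : CatIdeal (FGModuleCat.{max v w} Λ))
    {M N : FGModuleCat.{max v w} Λ} {f : M ⟶ N}
    (hf : (restr Λ G).map ((pushdown.{u, v} Λ G).map f) ∈ I.hom _ _) : f ∈ I.hom M N := by
  let i : M ⟶ (restr Λ G).obj ((pushdown.{u, v} Λ G).obj M) :=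
    FGModuleCat.homMk (X := M) (Y := (restr Λ G).obj ((pushdown.{u, v} Λ G).obj M))
      { toFun := fun m => (PushdownObj.incl (show M from m) : PushdownObj G M)
        map_add' := fun m n => PushdownObj.incl_add (M := M) m n
        map_smul' := fun l m => PushdownObj.incl_smul (M := M) l m }
  let p : (restr Λ G).obj ((pushdown.{u, v} Λ G).obj N) ⟶ N :=
    FGModuleCat.homMk (X := (restr Λ G).obj ((pushdown.{u, v} Λ G).obj N)) (Y := N)
      { toFun := fun φ => (show G → N from φ) 1
        map_add' := fun _ _ => rfl
        map_smul' := fun l φ => by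
          refine (smul_restr_pushdown_apply N l φ 1).trans ?_
          rw [inv_one, one_smul]
          rfl }
  have h : i ≫ (restr Λ G).map ((pushdown.{u, v} Λ G).map f) ≫ p = f := by
    refine FGModuleCat.hom_ext (LinearMap.ext fun m => ?_)
    exact congrArg f.hom.hom (PushdownObj.incl_apply_one (G := G) (show M from m))
  rw [← h]
  exact I.comp_mem _ (I.mem_comp _ hf)

end Pushdown

/-! ### The restriction functor and the radical -/

section Restriction

variable {K : Type*} [Field K] {Λ : Type u} [Ring Λ] [Algebra K Λ] {G : Type w}

/-- Restriction of a `ΛG`-module along the automorphism `l ⊗ h ↦ χ(h) l ⊗ h`. -/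
def charTwist [Group G] [MulSemiringAction G Λ] [SMulCommClass G K Λ] (χ : G →* Kˣ) :
    FGModuleCat.{v} (SkewMonoidAlgebra Λ G) ⥤ FGModuleCat.{v} (SkewMonoidAlgebra Λ G) :=
  FGModuleCat.restrictScalars (twist χ) (FGModuleCat.finite_of_surjective _ (twist_surjective χ))

instance [Group G] [MulSemiringAction G Λ] [SMulCommClass G K Λ] (χ : G →* Kˣ) :
    (charTwist.{u, v} (Λ := Λ) χ).Additive := by unfold charTwist; infer_instance

instance [Group G] [MulSemiringAction G Λ] [SMulCommClass G K Λ] (χ : G →* Kˣ) :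
    (charTwist.{u, v} (Λ := Λ) χ).Full :=
  FGModuleCat.restrictScalars_full _ _ (twist_surjective χ)

theorem charTwist_single_smul [Group G] [MulSemiringAction G Λ] [SMulCommClass G K Λ]
    (χ : G →* Kˣ) (X : FGModuleCat.{v} (SkewMonoidAlgebra Λ G)) (h : G) (l : Λ)
    (x : (charTwist χ).obj X) :
    single h l • x = single h ((χ h : K) • l) • (show X from x) := by
  rw [← twist_single]
  rfl

theorem pushdown_restr_single_smul_apply [Group G] [Finite G] [MulSemiringAction G Λ]
    (X : FGModuleCat.{max v w} (SkewMonoidAlgebra Λ G)) (h : G) (l : Λ)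
    (φ : (pushdown.{u, v} Λ G).obj ((restr Λ G).obj X)) (k : G) :
    (show G → X from single h l • φ) k =
      (single (1 : G) (k⁻¹ • l) • (show G → X from φ) (h⁻¹ * k) : X) :=
  PushdownObj.single_smul_apply (M := (restr Λ G).obj X) h l (show PushdownObj G _ from φ) k

variable [CommGroup G] [MulSemiringAction G Λ] [SMulCommClass G K Λ]

section Computations

variable {X : Type*} [AddCommGroup X] [Module (SkewMonoidAlgebra Λ G) X] (χ : G →* Kˣ)

/-- The map `φ ↦ ∑ k, χ(k) k • φ k` is equivariant if the target is twisted by `χ`. -/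
theorem sum_single_char_smul [Fintype G] (h : G) (l : Λ) (φ : G → X) :
    ∑ k : G, single k ((χ k : K) • (1 : Λ)) • single (1 : G) (k⁻¹ • l) • φ (h⁻¹ * k) =
      single h ((χ h : K) • l) • ∑ k : G, single k ((χ k : K) • (1 : Λ)) • φ k := by
  rw [Finset.smul_sum]
  refine (Fintype.sum_equiv (Equiv.mulLeft h) _ _ fun k => ?_).symm
  rw [smul_smul, smul_smul, single_mul_single, single_mul_single]
  simp only [Equiv.coe_mulLeft]
  rw [inv_mul_cancel_left, mul_one, smul_inv_smul, smul_comm h, smul_one, mul_smul_comm, mul_one,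
    smul_smul, smul_mul_assoc, one_mul, map_mul, Units.val_mul, mul_comm (χ k : K)]

/-- The map `x ↦ (k ↦ c χ(k⁻¹) k⁻¹ • x)` is equivariant if the source is twisted by `χ`. -/
theorem single_char_smul (c : K) (h k : G) (l : Λ) (x : X) :
    single k⁻¹ ((c * χ k⁻¹ : K) • (1 : Λ)) • single h ((χ h : K) • l) • x =
      single (1 : G) (k⁻¹ • l) • single (h⁻¹ * k)⁻¹ ((c * χ (h⁻¹ * k)⁻¹ : K) • (1 : Λ)) • x := by
  rw [smul_smul, smul_smul, single_mul_single, single_mul_single]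
  simp [smul_smul, smul_comm k⁻¹ (χ h : K) l, mul_comm, mul_left_comm]

/-- By the orthogonality relation, the compositions of the two preceding maps, with `c = |G|⁻¹`, add
up to the identity. -/
theorem sum_char_single_smul [IsAlgClosed K] (hG : (Nat.card G : K) ≠ 0) [Fintype G]
    [Fintype (G →* Kˣ)] (φ : G → X) (j : G) :
    ∑ χ : G →* Kˣ, single j⁻¹ (((Nat.card G : K)⁻¹ * χ j⁻¹ : K) • (1 : Λ)) •
      ∑ k : G, single k ((χ k : K) • (1 : Λ)) • φ k = φ j := by
  classical
  have h : ∀ (χ : G →* Kˣ) (k : G), single j⁻¹ (((Nat.card G : K)⁻¹ * χ j⁻¹ : K) • (1 : Λ)) •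
      single k ((χ k : K) • (1 : Λ)) • φ k =
        single (j⁻¹ * k) (((Nat.card G : K)⁻¹ * (χ (j⁻¹ * k) : K)) • (1 : Λ)) • φ k := by
    intro χ k
    rw [smul_smul, single_mul_single]
    rw [smul_comm j⁻¹, smul_one, mul_smul_comm, mul_one, smul_smul, map_mul, Units.val_mul,
      mul_comm (χ k : K), mul_assoc]
  have hsum : ∀ g : G, ∑ χ : G →* Kˣ, single g (((Nat.card G : K)⁻¹ * (χ g : K)) • (1 : Λ)) =
      single g (((Nat.card G : K)⁻¹ * if g = 1 then (Nat.card G : K) else 0) • (1 : Λ)) := by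
    intro g
    rw [← sum_monoidHom_units_apply hG, Finset.mul_sum, Finset.sum_smul]
    exact (_root_.map_sum (singleAddHom g) _ _).symm
  simp only [Finset.smul_sum, h]
  rw [Finset.sum_comm, Finset.sum_eq_single j]
  · rw [← Finset.sum_smul, hsum, if_pos (inv_mul_cancel j), inv_mul_cancel₀ hG, one_smul,
      inv_mul_cancel, ← one_def, one_smul]
  · intro k _ hk
    rw [← Finset.sum_smul, hsum, if_neg fun h => hk (inv_mul_eq_one.1 h).symm, mul_zero, zero_smul,
      single_zero, zero_smul]
  · simp

end Computations

variable [Finite G]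

/-- The projection of `ΛG ⊗_Λ X` onto the twist of `X` by the character `χ`. -/
def pushdownRestrProj [Fintype G] (χ : G →* Kˣ)
    (X : FGModuleCat.{max v w} (SkewMonoidAlgebra Λ G)) :
    (pushdown.{u, v} Λ G).obj ((restr Λ G).obj X) ⟶ (charTwist χ).obj X :=
  FGModuleCat.homMk (linearMapOfSingle
    (X := (pushdown.{u, v} Λ G).obj ((restr Λ G).obj X)) (Y := (charTwist χ).obj X)
    (fun φ => (∑ k : G, single k ((χ k : K) • (1 : Λ)) • (show G → X from φ) k : X))
    (fun φ ψ => by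
      refine Eq.trans ?_ Finset.sum_add_distrib
      exact Finset.sum_congr rfl fun k _ =>
        smul_add _ ((show G → X from φ) k) ((show G → X from ψ) k))
    (fun h l φ => by
      refine (Eq.trans ?_ (sum_single_char_smul χ h l (show G → X from φ))).trans
        (charTwist_single_smul χ X h l _).symm
      exact Finset.sum_congr rfl fun k _ =>
        congrArg (fun x : X => single k ((χ k : K) • (1 : Λ)) • x)
          (pushdown_restr_single_smul_apply X h l φ k)))

/-- The inclusion of the twist of `X` by the character `χ` into `ΛG ⊗_Λ X`. The factor `|G|⁻¹` makes
the projection `pushdownRestrProj χ X` a left inverse. -/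
def pushdownRestrIncl (χ : G →* Kˣ) (X : FGModuleCat.{max v w} (SkewMonoidAlgebra Λ G)) :
    (charTwist χ).obj X ⟶ (pushdown.{u, v} Λ G).obj ((restr Λ G).obj X) :=
  FGModuleCat.homMk (linearMapOfSingle
    (X := (charTwist χ).obj X) (Y := (pushdown.{u, v} Λ G).obj ((restr Λ G).obj X))
    (fun x => ((fun k => single k⁻¹ (((Nat.card G : K)⁻¹ * χ k⁻¹ : K) • (1 : Λ)) •
      (show X from x) : G → X)))
    (fun x y => funext fun _ => smul_add _ (show X from x) (show X from y))
    (fun h l x => funext fun (k : G) =>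
      ((congrArg (fun x : X => single k⁻¹ (((Nat.card G : K)⁻¹ * χ k⁻¹ : K) • (1 : Λ)) • x)
        (charTwist_single_smul χ X h l x)).trans
          (single_char_smul χ _ h k l (show X from x))).trans
            (pushdown_restr_single_smul_apply X h l
              (fun k => single k⁻¹ (((Nat.card G : K)⁻¹ * χ k⁻¹ : K) • (1 : Λ)) •
                (show X from x) : G → X) k).symm))

/-- The push-down of the restriction of `f` is the direct sum of the twists of `f` by the characters
of `G`. -/
theorem sum_pushdownRestr [IsAlgClosed K] (hG : (Nat.card G : K) ≠ 0) [Fintype G]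
    [Fintype (G →* Kˣ)] {X Y : FGModuleCat.{max v w} (SkewMonoidAlgebra Λ G)} (f : X ⟶ Y) :
    (pushdown.{u, v} Λ G).map ((restr Λ G).map f) =
      ∑ χ : G →* Kˣ, pushdownRestrProj χ X ≫ (charTwist χ).map f ≫ pushdownRestrIncl χ Y := by
  refine FGModuleCat.hom_ext (LinearMap.ext fun φ => ?_)
  rw [FGModuleCat.sum_apply]
  refine funext fun j => ?_
  refine Eq.trans ?_ (Finset.sum_apply (M := fun _ : G => (Y : Type _)) j _ _).symm
  have h := congrArg f.hom.hom
    (sum_char_single_smul (Λ := Λ) hG (show G → X from φ) j)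
  refine h.symm.trans ((_root_.map_sum f.hom.hom _ _).trans ?_)
  refine Finset.sum_congr rfl fun χ _ => ?_
  change _ = single j⁻¹ (((Nat.card G : K)⁻¹ * χ j⁻¹ : K) • (1 : Λ)) •
      f.hom.hom (∑ k : G, single k ((χ k : K) • (1 : Λ)) • (show G → X from φ) k)
  exact map_smul f.hom.hom _ _

/-- The restriction functor maps the Jacobson radical into the Jacobson radical. It suffices to check
this after push-down, where the restriction of `f` becomes the direct sum of the twists of `f` by the
characters of `G`. -/
theorem mapsTo_catJacobson_restr [IsAlgClosed K] (hG : (Nat.card G : K) ≠ 0) :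
    CatIdeal.MapsTo (restr.{u, max v w} Λ G)
      (catJacobson (FGModuleCat.{max v w} (SkewMonoidAlgebra Λ G)))
      (catJacobson (FGModuleCat.{max v w} Λ)) := by
  have := Fintype.ofFinite G
  have := Fintype.ofFinite (G →* Kˣ)
  intro X Y f hf
  refine mem_catJacobson_of_map (pushdown.{u, v} Λ G) ?_
  rw [sum_pushdownRestr hG]
  exact sum_mem fun χ _ => CatIdeal.comp_mem _ _ (CatIdeal.mem_comp _ _
    (mapsTo_catJacobson_of_full (charTwist χ) hf))

end Restriction

end

theorem theorem4p3 {K : Type*} [Field K] [IsAlgClosed K]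
    {Λ : Type u} [Ring Λ] [Algebra K Λ] [FiniteDimensional K Λ]
    {G : Type w} [CommGroup G] [Finite G] [MulSemiringAction G Λ] [SMulCommClass G K Λ]
    (hG : (Nat.card G : K) ≠ 0)
    (α : Ordinal.{v}) {M N : FGModuleCat.{max u w} Λ} (f : M ⟶ N) :
    (f ∈ (radPow (FGModuleCat.{max u w} Λ) α).hom M N →
      (pushdown Λ G).map f ∈
        (radPow (FGModuleCat.{max u w} (SkewMonoidAlgebra Λ G)) α).hom
          ((pushdown Λ G).obj M) ((pushdown Λ G).obj N)) ∧
    (f ∈ (radPow (FGModuleCat.{max u w} Λ) α).hom M N ∧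
        f ∉ (radPow (FGModuleCat.{max u w} Λ) (α + 1)).hom M N →
      (pushdown Λ G).map f ∈
          (radPow (FGModuleCat.{max u w} (SkewMonoidAlgebra Λ G)) α).hom
            ((pushdown Λ G).obj M) ((pushdown Λ G).obj N) ∧
        (pushdown Λ G).map f ∉
          (radPow (FGModuleCat.{max u w} (SkewMonoidAlgebra Λ G)) (α + 1)).hom
            ((pushdown Λ G).obj M) ((pushdown Λ G).obj N)) := by
  have : IsArtinianRing Λ := IsArtinianRing.of_finite K Λ
  have := SkewMonoidAlgebra.isArtinianRing Λ G
  have hF : CatIdeal.MapsTo (pushdown.{u, u} Λ G) (catRad (FGModuleCat.{max u w} Λ))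
      (catRad (FGModuleCat.{max u w} (SkewMonoidAlgebra Λ G))) := by
    rw [FGModuleCat.catRad_eq_catJacobson, FGModuleCat.catRad_eq_catJacobson]
    exact mapsTo_catJacobson_pushdown
  have hR : CatIdeal.MapsTo (SkewMonoidAlgebra.restr Λ G)
      (catRad (FGModuleCat.{max u w} (SkewMonoidAlgebra Λ G)))
      (catRad (FGModuleCat.{max u w} Λ)) := by
    rw [FGModuleCat.catRad_eq_catJacobson, FGModuleCat.catRad_eq_catJacobson]
    exact mapsTo_catJacobson_restr.{u, u} hG
  exact ⟨fun hf => hF.radPow α hf, fun hf => ⟨hF.radPow α hf.1, fun h =>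
    hf.2 (mem_of_restr_pushdown_mem _ (hR.radPow (α + 1) h))⟩⟩
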